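/- Theorem (Axiomatic Characterization of Mutual Information). Definitions. A finite random variable on a probability space $(\Omega,\Sigma,\mu)$ is a surjective function $X:\Omega\to\mathcal X$ onto a finite set $\mathcal X$ (its alphabet) with $X^{-1}(x)\in\Sigma$ for all $x\in\mathcal X$; its probability mass function is $p(x)=\mu(X^{-1}(x))$ and its Shannon entropy is $H(X)=-\sum_{x}p(x)\log p(x)$ (with $0\log 0=0$). For a pair $(X,Y)$ of finite random variables on the same $\Omega$, with alphabets $\mathcal X,\mathcal Y$, put $$\vartheta_{X,Y}(x,y)=\mu\big(X^{-1}(x)\cap Y^{-1}(y)\big),\qquad H(X,Y)=-\sum_{x,y}\vartheta_{X,Y}(x,y)\log\vartheta_{X,Y}(x,y),\qquad \mathbb I(X,Y)=H(X)+H(Y)-H(X,Y).$$ The conditional distribution function of $Y$ given $X=x$ is $q_{Y|X}(y|x)=\vartheta_{X,Y}(x,y)/p(x)$ if $p(x)\neq 0$, and $0$ otherwise. Let $F$ be a map assigning to every ordered pair $(X,Y)$ of finite random variables on a common probability space (the probability space being arbitrary) a real number $F(X,Y)$. Consider the following conditions. 1. (Continuity) Let $(X_n,Y_n)$, $n\in\mathbb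 N$, and $(X,Y)$ be pairs of finite random variables on the same $\Omega$, such that for some $N$ and all $n\ge N$ the alphabets of $X_n$ and $Y_n$ equal those of $X$ and $Y$, and $\vartheta_{X_n,Y_n}\to\vartheta_{X,Y}$ pointwise. Then $F(X_n,Y_n)\to F(X,Y)$. 2. (Strong additivity) Let $X$ be a finite random variable (on any probability space) with probability mass function $p:\mathcal X\to[0,1]$, and let $(Y^x,Z^x)_{x\in\mathcal X}$ be pairs of finite random variables on a common probability space $(\Omega,\Sigma,\mu)$. Let $\bigoplus_x p(x)Y^x$ be the random variable $(x,\omega)\mapsto (x,Y^{x}(\omega))$ on the product probability space $(\mathcal X\times\Omega,\,p\times\mu)$, with alphabet the disjoint union $\coprod_x\mathcal Y^x$ of the alphabets of the $Y^x$, and similarly for $Z$. Then $$F\Big(\bigoplus_{x}p(x)Y^x,\ \bigoplus_{x}p(x)Z^x\Big)=F(X,X)+\sum_{x\in\mathcal X}p(x)F(Y^x,Z^x).$$ 3. (Symmetry) $F(X,Y)=F(Y,X)$ for every pair $(X,Y)$. 4. (Weak functoriality) $F(X,Z)=F(X,Y)+F(Y,Z)-F(Y,Y)$ for every Markov triangle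 $(X,Y,Z)$, i.e. every triple of finite random variables on a common probability space, with alphabets $\mathcal X,\mathcal Y,\mathcal Z$, for which there is a function $h:\mathcal Z\times\mathcal X\to\mathcal Y$ with $$q_{Z|X}(z|x)=q_{Z|Y}\big(z|h(z,x)\big)\,q_{Y|X}\big(h(z,x)|x\big)\qquad\text{for all }(z,x)\in\mathcal Z\times\mathcal X.$$ 5. (Invariance under pullbacks) $F(X,Y)=F(X\circ\pi,Y\circ\pi)$ for every measure-preserving map $\pi:\Omega'\to\Omega$ of probability spaces and every pair $(X,Y)$ of finite random variables on $\Omega$ such that $X\circ\pi$ and $Y\circ\pi$ are again finite random variables (i.e. are still surjective onto the alphabets of $X$ and $Y$). 6. (Vacuity) $F(X,C)=0$ for all $X$ and every constant random variable $C$ on the same probability space as $X$. If $F$ takes only non-negative values and satisfies 1–6, then there is a constant $c\ge 0$ with $F(X,Y)=c\,\mathbb I(X,Y)$ for every pair $(X,Y)$. Conversely, mutual information $\mathbb I$ takes only non-negative values and satisfies 1–6. -/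

import Mathlib

open MeasureTheory Filter Topology

universe u

namespace FinInfo

/-- A probability space `(Ω, Σ, μ)`. -/
structure ProbSpace : Type (u + 1) where
  carrier : Type u
  [meas : MeasurableSpace carrier]
  μ : Measure carrier
  [prob : IsProbabilityMeasure μ]

attribute [instance] ProbSpace.meas ProbSpace.prob

/-- A finite random variable on `Ω`: a surjection onto a finite set (its alphabet) all of whose
fibres are measurable. -/
structure FRV (Ω : ProbSpace.{u}) : Type (u + 1) where
  alphabet : Type u
  [fin : Finite alphabet]
  toFun : Ω.carrier → alphabet
  surj : Function.Surjective toFun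
  measurableSet_fiber : ∀ x, MeasurableSet (toFun ⁻¹' {x})

attribute [instance] FRV.fin

noncomputable instance FRV.fintype {Ω : ProbSpace.{u}} (X : FRV Ω) : Fintype X.alphabet :=
  Fintype.ofFinite _

/-- The probability mass function `p(x) = μ(X⁻¹(x))`. -/
noncomputable def FRV.pmf {Ω : ProbSpace.{u}} (X : FRV Ω) (x : X.alphabet) : ℝ :=
  Ω.μ.real (X.toFun ⁻¹' {x})

/-- The joint distribution function `ϑ(x, y) = μ(X⁻¹(x) ∩ Y⁻¹(y))`. -/
noncomputable def joint {Ω : ProbSpace.{u}} (X Y : FRV Ω) (x : X.alphabet) (y : Y.alphabet) : ℝ :=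
  Ω.μ.real (X.toFun ⁻¹' {x} ∩ Y.toFun ⁻¹' {y})

/-- The conditional distribution function `q(y|x) = ϑ(x, y) / p(x)` of `Y` given `X = x`, which is
`0` by convention when `p(x) = 0`. -/
noncomputable def condDist {Ω : ProbSpace.{u}} (X Y : FRV Ω) (x : X.alphabet) (y : Y.alphabet) : ℝ :=
  if X.pmf x ≠ 0 then joint X Y x y / X.pmf x else 0

/-- The Shannon entropy `H(X) = -∑ p(x) log p(x)`, with `0 log 0 = 0`. -/
noncomputable def entropy {Ω : ProbSpace.{u}} (X : FRV Ω) : ℝ :=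
  -∑ x, X.pmf x * Real.log (X.pmf x)

/-- The joint entropy `H(X, Y)`. -/
noncomputable def jointEntropy {Ω : ProbSpace.{u}} (X Y : FRV Ω) : ℝ :=
  -∑ x, ∑ y, joint X Y x y * Real.log (joint X Y x y)

/-- The type of real-valued maps on ordered pairs of finite random variables with a common
domain, where the domain ranges over all probability spaces. -/
abbrev PairMap : Type (u + 1) := (Ω : ProbSpace.{u}) → FRV Ω → FRV Ω → ℝ

/-- The mutual information `I(X, Y) = H(X) + H(Y) - H(X, Y)`. -/
noncomputable def mutualInfo : PairMap.{u} := fun _ X Y =>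
  entropy X + entropy Y - jointEntropy X Y

/-! ### Weak convergence and continuity -/

/-- Weak convergence `(X_n, Y_n) → (X, Y)`: from some index `N` on, the alphabets of `X_n` and `Y_n`
are those of `X` and `Y`, and the joint distribution functions, which are the probability mass
functions of the product variables `ω ↦ (X_n(ω), Y_n(ω))`, converge pointwise. -/
def PairConverges {Ω : ProbSpace.{u}} (Xs Ys : ℕ → FRV Ω) (X Y : FRV Ω) : Prop :=
  ∃ (N : ℕ) (hX : ∀ n, (Xs (n + N)).alphabet = X.alphabet)
    (hY : ∀ n, (Ys (n + N)).alphabet = Y.alphabet),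
    ∀ (x : X.alphabet) (y : Y.alphabet),
      Tendsto (fun n => joint (Xs (n + N)) (Ys (n + N)) (cast (hX n).symm x) (cast (hY n).symm y))
        atTop (𝓝 (joint X Y x y))

def IsContinuous (F : PairMap.{u}) : Prop :=
  ∀ (Ω : ProbSpace.{u}) (Xs Ys : ℕ → FRV Ω) (X Y : FRV Ω), PairConverges Xs Ys X Y →
    Tendsto (fun n => F Ω (Xs n) (Ys n)) atTop (𝓝 (F Ω X Y))

/-! ### Convex sums and strong additivity -/

/-- The measure on the finite discrete space `𝒳` given by the weights `p`. -/
noncomputable def weightMeasure {𝒳 : Type u} [Fintype 𝒳] (p : 𝒳 → ℝ) : @Measure 𝒳 ⊤ :=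
  letI : MeasurableSpace 𝒳 := ⊤
  ∑ x, ENNReal.ofReal (p x) • Measure.dirac x

theorem isProbabilityMeasure_weightMeasure {𝒳 : Type u} [Fintype 𝒳] (p : stdSimplex ℝ 𝒳) :
    letI : MeasurableSpace 𝒳 := ⊤
    IsProbabilityMeasure (weightMeasure p.1) := by
  let _ : MeasurableSpace 𝒳 := ⊤
  constructor
  simp only [weightMeasure, Measure.coe_finsetSum, Finset.sum_apply, Measure.smul_apply,
    smul_eq_mul, measure_univ, mul_one]
  rw [← ENNReal.ofReal_sum_of_nonneg (fun x _ => p.2.1 x), p.2.2, ENNReal.ofReal_one]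

/-- The convex sum of probability spaces `⨁ₓ p(x)(Ω, Σ, μ) = (𝒳 × Ω, 𝒳 × Σ, p × μ)`, for a
probability distribution `p` on the finite set `𝒳`. -/
noncomputable def ProbSpace.convexSum {𝒳 : Type u} [Fintype 𝒳] (p : stdSimplex ℝ 𝒳)
    (Ω : ProbSpace.{u}) : ProbSpace.{u} :=
  letI : MeasurableSpace 𝒳 := ⊤
  haveI := isProbabilityMeasure_weightMeasure p
  { carrier := 𝒳 × Ω.carrier
    μ := (weightMeasure p.1).prod Ω.μ }

/-- The `p`-weighted convex sum `⨁ₓ p(x) Yˣ` of random variables, `(x, ω) ↦ Yˣ(ω)`, whose alphabet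
is the disjoint union of the alphabets of the `Yˣ`. -/
noncomputable def FRV.convexSum {𝒳 : Type u} [Fintype 𝒳] (p : stdSimplex ℝ 𝒳)
    {Ω : ProbSpace.{u}} (Y : 𝒳 → FRV Ω) : FRV (ProbSpace.convexSum p Ω) where
  alphabet := Σ x, (Y x).alphabet
  toFun := fun a => ⟨a.1, (Y a.1).toFun a.2⟩
  surj := by
    rintro ⟨x, y⟩
    obtain ⟨ω, hω⟩ := (Y x).surj y
    exact ⟨(x, ω), by simp [hω]⟩
  measurableSet_fiber := by
    rintro ⟨x, y⟩
    let _ : MeasurableSpace 𝒳 := ⊤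
    have h : (fun a : 𝒳 × Ω.carrier => (⟨a.1, (Y a.1).toFun a.2⟩ : Σ x, (Y x).alphabet)) ⁻¹'
        {⟨x, y⟩} = {x} ×ˢ ((Y x).toFun ⁻¹' {y}) := by
      ext ⟨x', ω⟩
      constructor
      · intro ha
        simp only [Set.mem_preimage, Set.mem_singleton_iff, Sigma.mk.injEq] at ha
        obtain ⟨rfl, ha⟩ := ha
        exact ⟨rfl, eq_of_heq ha⟩
      · rintro ⟨ha, hb⟩
        simp only [Set.mem_singleton_iff] at ha
        subst ha
        simpa using hb
    have hm : MeasurableSet (({x} : Set 𝒳) ×ˢ ((Y x).toFun ⁻¹' {y})) :=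
      MeasurableSet.prod trivial ((Y x).measurableSet_fiber y)
    rw [← h] at hm
    exact hm

theorem FRV.pmf_mem_stdSimplex {Ω : ProbSpace.{u}} (X : FRV Ω) :
    X.pmf ∈ stdSimplex ℝ X.alphabet := by
  refine ⟨fun x => measureReal_nonneg, ?_⟩
  have h := measureReal_biUnion_finset (μ := Ω.μ) (s := (Finset.univ : Finset X.alphabet))
    (f := fun x => X.toFun ⁻¹' {x})
    (fun x _ y _ hxy => Disjoint.preimage _ (by simpa using hxy))
    (fun x _ => X.measurableSet_fiber x)
  have hU : (⋃ x ∈ (Finset.univ : Finset X.alphabet), X.toFun ⁻¹' {x}) = Set.univ := by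
    ext ω; simp
  rw [hU, probReal_univ] at h
  exact h.symm

/-- The probability mass function of `X` as a probability distribution on its alphabet. -/
noncomputable def FRV.dist {Ω : ProbSpace.{u}} (X : FRV Ω) : stdSimplex ℝ X.alphabet :=
  ⟨X.pmf, X.pmf_mem_stdSimplex⟩

def IsStronglyAdditive (F : PairMap.{u}) : Prop :=
  ∀ (Ω' : ProbSpace.{u}) (X : FRV Ω') (Ω : ProbSpace.{u}) (Y Z : X.alphabet → FRV Ω),
    F (ProbSpace.convexSum X.dist Ω) (FRV.convexSum X.dist Y) (FRV.convexSum X.dist Z) =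
      F Ω' X X + ∑ x, X.pmf x * F Ω (Y x) (Z x)

/-! ### The remaining axioms -/

def IsSymmetric (F : PairMap.{u}) : Prop :=
  ∀ (Ω : ProbSpace.{u}) (X Y : FRV Ω), F Ω X Y = F Ω Y X

/-- `(X, Y, Z)` is a Markov triangle: there is a mediator function `h : 𝒵 × 𝒳 → 𝒴` with
`r(z|x) = p(z|h(z,x)) q(h(z,x)|x)`, where `q`, `p`, `r` are the conditional distribution functions
of `Y` given `X`, of `Z` given `Y`, and of `Z` given `X`. -/
def IsMarkovTriangle {Ω : ProbSpace.{u}} (X Y Z : FRV Ω) : Prop :=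
  ∃ h : Z.alphabet × X.alphabet → Y.alphabet, ∀ (z : Z.alphabet) (x : X.alphabet),
    condDist X Z x z = condDist Y Z (h (z, x)) z * condDist X Y x (h (z, x))

def IsWeaklyFunctorial (F : PairMap.{u}) : Prop :=
  ∀ (Ω : ProbSpace.{u}) (X Y Z : FRV Ω), IsMarkovTriangle X Y Z →
    F Ω X Z = F Ω X Y + F Ω Y Z - F Ω Y Y

/-- The random variable `X ∘ π`, for `π` measure-preserving with `X ∘ π` still surjective. -/
def FRV.pullback {Ω Ω' : ProbSpace.{u}} (X : FRV Ω) (π : Ω'.carrier → Ω.carrier)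
    (hπ : MeasurePreserving π Ω'.μ Ω.μ) (hX : Function.Surjective (X.toFun ∘ π)) : FRV Ω' where
  alphabet := X.alphabet
  toFun := X.toFun ∘ π
  surj := hX
  measurableSet_fiber := fun x => hπ.measurable (X.measurableSet_fiber x)

/-- Invariance under all measure-preserving `π` for which `X ∘ π` and `Y ∘ π` are again finite
random variables, that is, still surjective onto their alphabets (automatic if `π` is). -/
def IsInvariantUnderPullbacks (F : PairMap.{u}) : Prop :=
  ∀ (Ω Ω' : ProbSpace.{u}) (π : Ω'.carrier → Ω.carrier) (hπ : MeasurePreserving π Ω'.μ Ω.μ)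
    (X Y : FRV Ω) (hX : Function.Surjective (X.toFun ∘ π))
    (hY : Function.Surjective (Y.toFun ∘ π)),
    F Ω X Y = F Ω' (X.pullback π hπ hX) (Y.pullback π hπ hY)

/-- `C` is a constant random variable. -/
def FRV.IsConstant {Ω : ProbSpace.{u}} (C : FRV Ω) : Prop :=
  ∀ ω ω', C.toFun ω = C.toFun ω'

def VanishesOnConstants (F : PairMap.{u}) : Prop :=
  ∀ (Ω : ProbSpace.{u}) (X C : FRV Ω), C.IsConstant → F Ω X C = 0

/-- The six axioms of the characterization of mutual information. -/
structure SatisfiesAxioms (F : PairMap.{u}) : Prop where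
  continuous : IsContinuous F
  stronglyAdditive : IsStronglyAdditive F
  symmetric : IsSymmetric F
  weaklyFunctorial : IsWeaklyFunctorial F
  invariantUnderPullbacks : IsInvariantUnderPullbacks F
  vanishesOnConstants : VanishesOnConstants F

end FinInfo

/-! That `mutualInfo` satisfies the axioms is direct computation with `Real.negMulLog`. The one
delicate axiom is weak functoriality: a mediator forces H(Z|X) = H(Z|Y) + H(Y|X)
(`IsMarkovTriangle.condDist_mul_eq_zero`).

For uniqueness, everything reduces to the diagonal. If Y is a function of X, the triangle X → Y →
constant and vacuity give F(X,Y) = F(Y,Y) (`apply_of_comp`). With W = (X,Y), the triangle X → W → Y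
then gives F(X,Y) = F(X,X) + F(Y,Y) - F(W,W), so it suffices that F(X,X) = c H(X)
(`eq_of_diagonal`).

On the diagonal F depends only on the distribution (`apply_of_pmf_eq`). Let φ(n) be its value at the
uniform distribution on n letters. Strong additivity is a grouping identity (`apply_add_sum`): it
makes φ completely additive and, together with F ≥ 0, makes n φ(n) monotone, whence φ = c log
(`exists_eq_mul_log`). The same identity gives c H for positive rational weights, and continuity
extends this to all distributions (`diagonal_eq`). -/

namespace FinInfo

/-! ### Marginals, joint distributions and entropy -/

section Basics

variable {Ω : ProbSpace.{u}}

theorem FRV.pmf_nonneg (X : FRV Ω) (x : X.alphabet) : 0 ≤ X.pmf x := measureReal_nonneg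

theorem FRV.sum_pmf (X : FRV Ω) : ∑ x, X.pmf x = 1 := X.pmf_mem_stdSimplex.2

theorem joint_nonneg (X Y : FRV Ω) (x : X.alphabet) (y : Y.alphabet) : 0 ≤ joint X Y x y :=
  measureReal_nonneg

theorem joint_comm (X Y : FRV Ω) (x : X.alphabet) (y : Y.alphabet) :
    joint X Y x y = joint Y X y x := by
  simp only [joint, Set.inter_comm]

theorem sum_joint (X Y : FRV Ω) (x : X.alphabet) : ∑ y, joint X Y x y = X.pmf x := by
  have h := measureReal_biUnion_finset (μ := Ω.μ) (s := (Finset.univ : Finset Y.alphabet))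
    (f := fun y => X.toFun ⁻¹' {x} ∩ Y.toFun ⁻¹' {y})
    (fun y _ y' _ hy => Disjoint.mono Set.inter_subset_right Set.inter_subset_right
      (Disjoint.preimage _ (by simpa using hy)))
    (fun y _ => (X.measurableSet_fiber x).inter (Y.measurableSet_fiber y))
  rw [FRV.pmf]
  unfold joint
  rw [← h]
  congr 1
  ext ω
  simp

theorem sum_joint' (X Y : FRV Ω) (y : Y.alphabet) : ∑ x, joint X Y x y = Y.pmf y := by
  simp_rw [joint_comm X Y, sum_joint]

theorem joint_le_pmf (X Y : FRV Ω) (x : X.alphabet) (y : Y.alphabet) :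
    joint X Y x y ≤ X.pmf x :=
  measureReal_mono Set.inter_subset_left

theorem joint_le_pmf' (X Y : FRV Ω) (x : X.alphabet) (y : Y.alphabet) :
    joint X Y x y ≤ Y.pmf y :=
  measureReal_mono Set.inter_subset_right

theorem joint_eq_zero_of_pmf (X Y : FRV Ω) {x : X.alphabet} (y : Y.alphabet) (h : X.pmf x = 0) :
    joint X Y x y = 0 :=
  le_antisymm (h ▸ joint_le_pmf X Y x y) (joint_nonneg ..)

theorem joint_self (X : FRV Ω) [DecidableEq X.alphabet] (x y : X.alphabet) :
    joint X X x y = if x = y then X.pmf x else 0 := by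
  split_ifs with h
  · subst h
    simp [joint, FRV.pmf]
  · have : X.toFun ⁻¹' {x} ∩ X.toFun ⁻¹' {y} = ∅ := by
      ext ω
      simp only [Set.mem_inter_iff, Set.mem_preimage, Set.mem_singleton_iff, Set.mem_empty_iff_false,
        iff_false, not_and]
      rintro rfl
      exact h
    simp [joint, this]

theorem entropy_eq (X : FRV Ω) : entropy X = ∑ x, Real.negMulLog (X.pmf x) := by
  simp [entropy, Real.negMulLog, Finset.sum_neg_distrib]

theorem jointEntropy_eq (X Y : FRV Ω) :
    jointEntropy X Y = ∑ x, ∑ y, Real.negMulLog (joint X Y x y) := by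
  simp [jointEntropy, Real.negMulLog, Finset.sum_neg_distrib]

theorem jointEntropy_comm (X Y : FRV Ω) : jointEntropy X Y = jointEntropy Y X := by
  rw [jointEntropy_eq, jointEntropy_eq, Finset.sum_comm]
  simp_rw [joint_comm X Y]

theorem jointEntropy_self (X : FRV Ω) : jointEntropy X X = entropy X := by
  classical
  simp [jointEntropy_eq, entropy_eq, joint_self, apply_ite Real.negMulLog]

/-! ### Conditional distributions -/

theorem condDist_nonneg (X Y : FRV Ω) (x : X.alphabet) (y : Y.alphabet) :
    0 ≤ condDist X Y x y := by
  unfold condDist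
  split_ifs
  · exact div_nonneg (joint_nonneg ..) (X.pmf_nonneg x)
  · exact le_rfl

theorem pmf_mul_condDist (X Y : FRV Ω) (x : X.alphabet) (y : Y.alphabet) :
    X.pmf x * condDist X Y x y = joint X Y x y := by
  unfold condDist
  split_ifs with h
  · field_simp
  · push Not at h
    rw [joint_eq_zero_of_pmf X Y y h, mul_zero]

theorem sum_condDist (X Y : FRV Ω) {x : X.alphabet} (h : X.pmf x ≠ 0) :
    ∑ y, condDist X Y x y = 1 := by
  simp only [condDist, if_pos h, ← Finset.sum_div, sum_joint, div_self h]

theorem pmf_ne_zero_of_condDist (X Y : FRV Ω) {x : X.alphabet} {y : Y.alphabet}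
    (h : condDist X Y x y ≠ 0) : Y.pmf y ≠ 0 := by
  intro hy
  apply h
  unfold condDist
  rw [joint_comm, joint_eq_zero_of_pmf Y X x hy]
  simp

/-- The chain rule for H(Y|X), the form in which a condition on conditional distributions, such as
the Markov condition, bears on entropies. -/
theorem jointEntropy_chain (X Y : FRV Ω) :
    jointEntropy X Y = entropy X + ∑ x, X.pmf x * ∑ y, Real.negMulLog (condDist X Y x y) := by
  rw [jointEntropy_eq, entropy_eq, ← Finset.sum_add_distrib]
  refine Finset.sum_congr rfl fun x _ => ?_
  by_cases h : X.pmf x = 0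
  · simp [joint_eq_zero_of_pmf X Y _ h, h]
  · simp_rw [← pmf_mul_condDist X Y x, Real.negMulLog_mul, Finset.sum_add_distrib]
    rw [← Finset.sum_mul, ← Finset.mul_sum, sum_condDist X Y h, one_mul]

end Basics

/-! ### Mutual information satisfies the axioms -/

/-- Gibbs' inequality: log t ≤ t - 1 at t = p(x)p(y)/ϑ(x,y) bounds each term ϑ log(ϑ/(p p)) below by
ϑ - p p, and these bounds sum to zero. -/
theorem mutualInfo_nonneg (Ω : ProbSpace.{u}) (X Y : FRV Ω) : 0 ≤ mutualInfo Ω X Y := by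
  have hX : entropy X = ∑ x, ∑ y, -(joint X Y x y * Real.log (X.pmf x)) := by
    simp only [Finset.sum_neg_distrib, ← Finset.sum_mul, sum_joint, entropy]
  have hY : entropy Y = ∑ x, ∑ y, -(joint X Y x y * Real.log (Y.pmf y)) := by
    rw [Finset.sum_comm]
    simp only [Finset.sum_neg_distrib, ← Finset.sum_mul, sum_joint', entropy]
  have h0 : ∑ x, ∑ y, (joint X Y x y - X.pmf x * Y.pmf y) = 0 := by
    simp only [Finset.sum_sub_distrib, sum_joint, ← Finset.mul_sum, Y.sum_pmf, mul_one, sub_self,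
      Finset.sum_const_zero]
  rw [mutualInfo, hX, hY, jointEntropy_eq, ← h0]
  simp only [← Finset.sum_add_distrib, ← Finset.sum_sub_distrib]
  refine Finset.sum_le_sum fun x _ => Finset.sum_le_sum fun y _ => ?_
  rcases (joint_nonneg X Y x y).eq_or_lt with h | h
  · rw [← h]
    simpa using mul_nonneg (X.pmf_nonneg x) (Y.pmf_nonneg y)
  · have hx : 0 < X.pmf x := h.trans_le (joint_le_pmf ..)
    have hy : 0 < Y.pmf y := h.trans_le (joint_le_pmf' ..)
    have hl := Real.log_le_sub_one_of_pos (div_pos (mul_pos hx hy) h)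
    rw [Real.log_div (mul_pos hx hy).ne' h.ne', Real.log_mul hx.ne' hy.ne'] at hl
    have := mul_le_mul_of_nonneg_left hl h.le
    rw [mul_sub _ (_ / _), mul_div_cancel₀ _ h.ne'] at this
    rw [Real.negMulLog]
    linarith

theorem mutualInfo_symmetric : IsSymmetric mutualInfo.{u} := by
  intro Ω X Y
  rw [mutualInfo, mutualInfo, jointEntropy_comm X Y]
  ring

theorem mutualInfo_invariant : IsInvariantUnderPullbacks mutualInfo.{u} := by
  intro Ω Ω' π hπ X Y hX hY
  have hj : ∀ x y, joint (X.pullback π hπ hX) (Y.pullback π hπ hY) x y = joint X Y x y := by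
    intro x y
    exact hπ.measureReal_preimage
      ((X.measurableSet_fiber x).inter (Y.measurableSet_fiber y)).nullMeasurableSet
  have hx : ∀ x, (X.pullback π hπ hX).pmf x = X.pmf x := fun x =>
    hπ.measureReal_preimage (X.measurableSet_fiber x).nullMeasurableSet
  have hy : ∀ x, (Y.pullback π hπ hY).pmf x = Y.pmf x := fun x =>
    hπ.measureReal_preimage (Y.measurableSet_fiber x).nullMeasurableSet
  simp only [mutualInfo, entropy_eq, jointEntropy_eq, hj, hx, hy]
  rfl

theorem mutualInfo_vanishesOnConstants : VanishesOnConstants mutualInfo.{u} := by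
  intro Ω X C hC
  have hu : ∀ c, C.toFun ⁻¹' {c} = Set.univ := by
    intro c
    obtain ⟨ω, rfl⟩ := C.surj c
    ext ω'
    simp [hC ω' ω]
  have : Nonempty Ω.carrier := nonempty_of_isProbabilityMeasure Ω.μ
  have : Nonempty C.alphabet := this.map C.toFun
  have : Subsingleton C.alphabet := ⟨fun a b => by
    obtain ⟨ω, rfl⟩ := C.surj a
    obtain ⟨ω', rfl⟩ := C.surj b
    exact hC _ _⟩
  have hp : ∀ c, C.pmf c = 1 := fun c => by rw [FRV.pmf, hu, probReal_univ]
  have hj : ∀ x c, joint X C x c = X.pmf x := fun x c => by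
    rw [joint, hu, Set.inter_univ, FRV.pmf]
  have hcard : Fintype.card C.alphabet = 1 := 
    Fintype.card_eq_one_iff_nonempty_unique.2 (unique_iff_subsingleton_and_nonempty _ |>.2 ⟨‹_›, ‹_›⟩)
  simp [mutualInfo, entropy_eq, jointEntropy_eq, hp, hj, Finset.card_univ, hcard]

/-- For fixed x the products q(z|y) q(y|x) are non-negative with total 1 over (z,y). Those with y =
h(z,x) equal q(z|x) and already sum to 1, so nothing is left for the others. -/
theorem IsMarkovTriangle.condDist_mul_eq_zero {Ω : ProbSpace.{u}} {X Y Z : FRV Ω}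
    {h : Z.alphabet × X.alphabet → Y.alphabet}
    (hh : ∀ z x, condDist X Z x z = condDist Y Z (h (z, x)) z * condDist X Y x (h (z, x)))
    {x : X.alphabet} (hx : X.pmf x ≠ 0) (z : Z.alphabet) (y : Y.alphabet) (hy : y ≠ h (z, x)) :
    condDist Y Z y z * condDist X Y x y = 0 := by
  classical
  have hnn : ∀ z y, 0 ≤ condDist Y Z y z * condDist X Y x y := fun z y =>
    mul_nonneg (condDist_nonneg ..) (condDist_nonneg ..)
  have hsplit : ∀ z, ∑ y, condDist Y Z y z * condDist X Y x y = condDist X Z x z +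
      ∑ y ∈ Finset.univ.erase (h (z, x)), condDist Y Z y z * condDist X Y x y := by
    intro z
    rw [hh, Finset.add_sum_erase _ (fun y => condDist Y Z y z * condDist X Y x y) (Finset.mem_univ _)]
  have htot : ∑ z, ∑ y, condDist Y Z y z * condDist X Y x y = 1 := by
    rw [Finset.sum_comm, ← sum_condDist X Y hx]
    refine Finset.sum_congr rfl fun y _ => ?_
    rw [← Finset.sum_mul]
    by_cases hy : condDist X Y x y = 0
    · simp [hy]
    · rw [sum_condDist Y Z (pmf_ne_zero_of_condDist X Y hy), one_mul]
  simp_rw [hsplit, Finset.sum_add_distrib] at htot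
  rw [sum_condDist X Z hx, add_eq_left,
    Finset.sum_eq_zero_iff_of_nonneg fun z _ => Finset.sum_nonneg fun y _ => hnn z y] at htot
  have := htot z (Finset.mem_univ z)
  rw [Finset.sum_eq_zero_iff_of_nonneg fun y _ => hnn z y] at this
  exact this y (by simp [hy])

theorem mutualInfo_weaklyFunctorial : IsWeaklyFunctorial mutualInfo.{u} := by
  classical
  rintro Ω X Y Z ⟨h, hh⟩
  have key : ∀ x, X.pmf x * ∑ z, Real.negMulLog (condDist X Z x z) =
      ∑ y, joint X Y x y * ∑ z, Real.negMulLog (condDist Y Z y z) +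
        X.pmf x * ∑ y, Real.negMulLog (condDist X Y x y) := by
    intro x
    by_cases hx : X.pmf x = 0
    · simp [hx, joint_eq_zero_of_pmf X Y _ hx]
    -- Only y = h(z,x) contributes, because `Real.negMulLog` vanishes at 0. Summing over all y makes
    -- the product rule for `Real.negMulLog` applicable without reference to h.
    have h1 : ∀ z, Real.negMulLog (condDist X Z x z) =
        ∑ y, Real.negMulLog (condDist Y Z y z * condDist X Y x y) := by
      intro z
      rw [Finset.sum_eq_single (h (z, x)), hh]
      · intro y _ hy
        rw [IsMarkovTriangle.condDist_mul_eq_zero hh hx z y hy, Real.negMulLog_zero]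
      · simp
    simp_rw [h1, Real.negMulLog_mul, ← pmf_mul_condDist X Y x]
    rw [Finset.sum_comm, Finset.mul_sum, Finset.mul_sum, ← Finset.sum_add_distrib]
    refine Finset.sum_congr rfl fun y _ => ?_
    rw [Finset.sum_add_distrib, ← Finset.mul_sum, ← Finset.sum_mul]
    by_cases hy : condDist X Y x y = 0
    · simp [hy]
    · rw [sum_condDist Y Z (pmf_ne_zero_of_condDist X Y hy)]
      ring
  have hsum := Finset.sum_congr (rfl : (Finset.univ : Finset X.alphabet) = _) fun x _ => key x
  rw [Finset.sum_add_distrib, Finset.sum_comm] at hsum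
  simp_rw [← Finset.sum_mul, sum_joint'] at hsum
  have hXZ := jointEntropy_chain X Z
  have hXY := jointEntropy_chain X Y
  have hYZ := jointEntropy_chain Y Z
  simp only [mutualInfo, jointEntropy_self]
  linarith

/-- Used for continuity: along a convergent sequence the alphabets agree with the limit's only
through a cast, so the sums are moved to fixed index types, with the marginals written through the
joint distribution alone. -/
theorem mutualInfo_eq_of_equiv {Ω : ProbSpace.{u}} (X Y : FRV Ω) {A B : Type u} [Fintype A]
    [Fintype B] (e : A ≃ X.alphabet) (e' : B ≃ Y.alphabet) :
    mutualInfo Ω X Y = ∑ a, Real.negMulLog (∑ b, joint X Y (e a) (e' b)) +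
      ∑ b, Real.negMulLog (∑ a, joint X Y (e a) (e' b)) -
      ∑ a, ∑ b, Real.negMulLog (joint X Y (e a) (e' b)) := by
  have h1 : ∀ a, ∑ b, joint X Y (e a) (e' b) = X.pmf (e a) := fun a => by
    rw [e'.sum_comp (fun y => joint X Y (e a) y), sum_joint]
  have h2 : ∀ b, ∑ a, joint X Y (e a) (e' b) = Y.pmf (e' b) := fun b => by
    rw [e.sum_comp (fun x => joint X Y x (e' b)), sum_joint']
  have h3 : ∀ a, ∑ b, Real.negMulLog (joint X Y (e a) (e' b)) =
      ∑ y, Real.negMulLog (joint X Y (e a) y) := fun a =>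
    e'.sum_comp (fun y => Real.negMulLog (joint X Y (e a) y))
  simp_rw [h1, h2, h3]
  rw [e.sum_comp (fun x => Real.negMulLog (X.pmf x)), e'.sum_comp (fun y => Real.negMulLog (Y.pmf y)),
    e.sum_comp (fun x => ∑ y, Real.negMulLog (joint X Y x y)), mutualInfo, entropy_eq, entropy_eq,
    jointEntropy_eq]

theorem mutualInfo_continuous : IsContinuous mutualInfo.{u} := by
  rintro Ω Xs Ys X Y ⟨N, hX, hY, hlim⟩
  rw [← tendsto_add_atTop_iff_nat N]
  have h1 : ∀ n, mutualInfo Ω (Xs (n + N)) (Ys (n + N)) = _ := fun n =>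
    mutualInfo_eq_of_equiv (Xs (n + N)) (Ys (n + N)) (Equiv.cast (hX n).symm)
      (Equiv.cast (hY n).symm)
  simp_rw [h1]
  rw [mutualInfo_eq_of_equiv X Y (Equiv.refl _) (Equiv.refl _)]
  have hc := Real.continuous_negMulLog
  refine ((tendsto_finsetSum _ fun a _ => ?_).add (tendsto_finsetSum _ fun b _ => ?_)).sub
    (tendsto_finsetSum _ fun a _ => tendsto_finsetSum _ fun b _ => ?_)
  · exact (hc.tendsto _).comp (tendsto_finsetSum _ fun b _ => hlim a b)
  · exact (hc.tendsto _).comp (tendsto_finsetSum _ fun a _ => hlim a b)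
  · exact (hc.tendsto _).comp (hlim a b)

end FinInfo

namespace FinInfo

/-! ### Convex sums -/

theorem weightMeasure_real_singleton {𝒳 : Type u} [Fintype 𝒳] (p : stdSimplex ℝ 𝒳) (x : 𝒳) :
    letI : MeasurableSpace 𝒳 := ⊤
    (weightMeasure p.1).real {x} = p.1 x := by
  classical
  let _ : MeasurableSpace 𝒳 := ⊤
  have : weightMeasure p.1 {x} = ENNReal.ofReal (p.1 x) := by
    simp [weightMeasure, Set.indicator_apply]
  simp only [measureReal_def, this]
  exact ENNReal.toReal_ofReal (p.2.1 x)

/-- `Fintype.sum_sigma` for an arbitrary `Fintype` instance on the sigma type. -/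
theorem sum_sigma_of_fintype {ι : Type*} {κ : ι → Type*} [Fintype ι] [∀ i, Fintype (κ i)]
    [Fintype (Σ i, κ i)] (f : (Σ i, κ i) → ℝ) : ∑ a, f a = ∑ i, ∑ k, f ⟨i, k⟩ := by
  rw [← Fintype.sum_sigma]
  congr!

section ConvexSum

variable {𝒳 : Type u} [Fintype 𝒳] (p : stdSimplex ℝ 𝒳) {Ω : ProbSpace.{u}} (Y Z : 𝒳 → FRV Ω)

/-- The letter `y` of the `x`-th summand, in the alphabet of the convex sum. -/
def FRV.convexSumLetter (x : 𝒳) (y : (Y x).alphabet) : (FRV.convexSum p Y).alphabet :=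
  (⟨x, y⟩ : Σ x, (Y x).alphabet)

/-- The event `{x} × s` of a convex sum of probability spaces. -/
def ProbSpace.cylinder (x : 𝒳) (s : Set Ω.carrier) : Set (ProbSpace.convexSum p Ω).carrier :=
  ({x} ×ˢ s : Set (𝒳 × Ω.carrier))

theorem FRV.convexSum_preimage (x : 𝒳) (y : (Y x).alphabet) :
    (FRV.convexSum p Y).toFun ⁻¹' {FRV.convexSumLetter p Y x y} =
      ProbSpace.cylinder p x ((Y x).toFun ⁻¹' {y}) := by
  ext ⟨x', ω⟩
  change (⟨x', (Y x').toFun ω⟩ : Σ x, (Y x).alphabet) = ⟨x, y⟩ ↔ x' = x ∧ (Y x).toFun ω = y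
  constructor
  · intro ha
    rw [Sigma.mk.injEq] at ha
    obtain ⟨rfl, ha⟩ := ha
    exact ⟨rfl, eq_of_heq ha⟩
  · rintro ⟨rfl, rfl⟩
    rfl

theorem ProbSpace.real_cylinder (x : 𝒳) (s : Set Ω.carrier) :
    (ProbSpace.convexSum p Ω).μ.real (ProbSpace.cylinder p x s) = p.1 x * Ω.μ.real s := by
  let _ : MeasurableSpace 𝒳 := ⊤
  have := isProbabilityMeasure_weightMeasure p
  rw [← weightMeasure_real_singleton p x]
  exact measureReal_prod_prod {x} s

theorem FRV.pmf_convexSum (x : 𝒳) (y : (Y x).alphabet) :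
    (FRV.convexSum p Y).pmf (FRV.convexSumLetter p Y x y) = p.1 x * (Y x).pmf y := by
  rw [FRV.pmf, FRV.convexSum_preimage, ProbSpace.real_cylinder, FRV.pmf]

theorem joint_convexSum (x : 𝒳) (y : (Y x).alphabet) (z : (Z x).alphabet) :
    joint (FRV.convexSum p Y) (FRV.convexSum p Z) (FRV.convexSumLetter p Y x y)
      (FRV.convexSumLetter p Z x z) = p.1 x * joint (Y x) (Z x) y z := by
  have h : ∀ s t : Set Ω.carrier, ProbSpace.cylinder p x s ∩ ProbSpace.cylinder p x t =
      ProbSpace.cylinder p x (s ∩ t) := fun s t => Set.prod_inter.symm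
  rw [joint, FRV.convexSum_preimage, FRV.convexSum_preimage, h, ProbSpace.real_cylinder, joint]

theorem joint_convexSum_of_ne {x x' : 𝒳} (h : x ≠ x') (y : (Y x).alphabet) (z : (Z x').alphabet) :
    joint (FRV.convexSum p Y) (FRV.convexSum p Z) (FRV.convexSumLetter p Y x y)
      (FRV.convexSumLetter p Z x' z) = 0 := by
  have h : ∀ s t : Set Ω.carrier, ProbSpace.cylinder p x s ∩ ProbSpace.cylinder p x' t = ∅ :=
    fun s t => Set.eq_empty_of_forall_notMem fun a ha => h (ha.1.1.symm.trans ha.2.1)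
  rw [joint, FRV.convexSum_preimage, FRV.convexSum_preimage, h, measureReal_empty]

theorem FRV.sum_convexSum (f : (FRV.convexSum p Y).alphabet → ℝ) :
    ∑ a, f a = ∑ x, ∑ y, f (FRV.convexSumLetter p Y x y) := by
  let _ : Fintype (Σ x, (Y x).alphabet) := (FRV.convexSum p Y).fintype
  exact sum_sigma_of_fintype (κ := fun x => (Y x).alphabet) f

theorem entropy_convexSum : entropy (FRV.convexSum p Y) =
    ∑ x, Real.negMulLog (p.1 x) + ∑ x, p.1 x * entropy (Y x) := by
  rw [entropy_eq, ← Finset.sum_add_distrib, FRV.sum_convexSum]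
  refine Finset.sum_congr rfl fun x _ => ?_
  simp_rw [FRV.pmf_convexSum, Real.negMulLog_mul, Finset.sum_add_distrib, ← Finset.sum_mul,
    ← Finset.mul_sum, FRV.sum_pmf, one_mul, entropy_eq]

/-- Letters from different summands never occur together, so the joint distribution is block
diagonal and H(p) enters only once. -/
theorem jointEntropy_convexSum : jointEntropy (FRV.convexSum p Y) (FRV.convexSum p Z) =
    ∑ x, Real.negMulLog (p.1 x) + ∑ x, p.1 x * jointEntropy (Y x) (Z x) := by
  rw [jointEntropy_eq, ← Finset.sum_add_distrib, FRV.sum_convexSum]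
  refine Finset.sum_congr rfl fun x _ => ?_
  have h : ∀ y : (Y x).alphabet, ∑ a, Real.negMulLog (joint (FRV.convexSum p Y)
      (FRV.convexSum p Z) (FRV.convexSumLetter p Y x y) a) =
      ∑ z, Real.negMulLog (p.1 x * joint (Y x) (Z x) y z) := by
    intro y
    rw [FRV.sum_convexSum, Finset.sum_eq_single x]
    · simp_rw [joint_convexSum]
    · intro x' _ hx'
      simp_rw [joint_convexSum_of_ne p Y Z hx'.symm]
      simp
    · simp
  simp_rw [h, Real.negMulLog_mul, Finset.sum_add_distrib, ← Finset.sum_mul,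
    ← Finset.mul_sum, sum_joint, FRV.sum_pmf, one_mul, jointEntropy_eq]

end ConvexSum

/-- H(p) occurs in both marginal entropies and in the joint one, so exactly one copy survives, and
it is I(X,X). -/
theorem mutualInfo_stronglyAdditive : IsStronglyAdditive mutualInfo.{u} := by
  intro Ω' X Ω Y Z
  simp only [mutualInfo, entropy_convexSum, jointEntropy_convexSum, jointEntropy_self,
    add_sub_cancel_right, mul_sub, mul_add, Finset.sum_add_distrib, Finset.sum_sub_distrib]
  rw [entropy_eq X]
  simp only [FRV.dist]
  ring

theorem mutualInfo_satisfiesAxioms : SatisfiesAxioms mutualInfo.{u} where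
  continuous := mutualInfo_continuous
  stronglyAdditive := mutualInfo_stronglyAdditive
  symmetric := mutualInfo_symmetric
  weaklyFunctorial := mutualInfo_weaklyFunctorial
  invariantUnderPullbacks := mutualInfo_invariant
  vanishesOnConstants := mutualInfo_vanishesOnConstants

/-! ### Random variables with prescribed distributions -/

/-- The coordinates of a product space. Its carrier is the full product, so letters of probability
zero are attained too. Strong additivity and continuity both need whole families on one space. -/
theorem exists_frv_pmf_eq {ι : Type u} (A : ι → Type u) [∀ i, Fintype (A i)]
    (p : ∀ i, stdSimplex ℝ (A i)) :
    ∃ (Ω : ProbSpace.{u}) (X : ∀ i, Ω.carrier → A i) (hs : ∀ i, Function.Surjective (X i))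
      (hm : ∀ i x, MeasurableSet (X i ⁻¹' {x})),
      ∀ i x, (FRV.mk (A i) (X i) (hs i) (hm i)).pmf x = (p i).1 x := by
  let _ : ∀ i, MeasurableSpace (A i) := fun _ => ⊤
  have hP : ∀ i, IsProbabilityMeasure (weightMeasure (p i).1) := fun i =>
    isProbabilityMeasure_weightMeasure (p i)
  have hne : ∀ i, Nonempty (A i) := fun i => nonempty_of_isProbabilityMeasure (weightMeasure (p i).1)
  have hmp := measurePreserving_eval_infinitePi fun i => weightMeasure (p i).1
  refine ⟨⟨∀ i, A i, Measure.infinitePi fun i => weightMeasure (p i).1⟩, fun i ω => ω i,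
    fun i => Function.surjective_eval i, fun i x => (hmp i).measurable trivial, fun i x => ?_⟩
  rw [← weightMeasure_real_singleton (p i) x]
  exact (hmp i).measureReal_preimage (MeasurableSet.nullMeasurableSet trivial)

/-- The uniform distribution. -/
noncomputable def uniformDist (A : Type u) [Fintype A] [Nonempty A] : stdSimplex ℝ A :=
  ⟨fun _ => (Fintype.card A : ℝ)⁻¹, fun _ => by positivity, by simp⟩

/-! ### Discrete models -/

/-- The discrete probability space on `A` given by the law of `f : Ω → A`. -/
noncomputable def ProbSpace.law (Ω : ProbSpace.{u}) {A : Type u} (f : Ω.carrier → A)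
    (hf : @Measurable _ _ _ ⊤ f) : ProbSpace.{u} :=
  letI : MeasurableSpace A := ⊤
  { carrier := A
    μ := Ω.μ.map f
    prob := Measure.isProbabilityMeasure_map hf.aemeasurable }

theorem measurable_top_of_finite {Ω : ProbSpace.{u}} {A : Type u} [Finite A] {f : Ω.carrier → A}
    (h : ∀ a, MeasurableSet (f ⁻¹' {a})) : @Measurable _ _ _ ⊤ f :=
  letI : MeasurableSpace A := ⊤
  measurable_to_countable' h

/-- A surjection onto a finite set, as a random variable on a discrete model. -/
noncomputable def ProbSpace.lawFRV (Ω : ProbSpace.{u}) {A B : Type u} [Finite B]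
    (f : Ω.carrier → A) (hf : @Measurable _ _ _ ⊤ f) (g : A → B) (hg : Function.Surjective g) :
    FRV (Ω.law f hf) where
  alphabet := B
  toFun := g
  surj := hg
  measurableSet_fiber := fun _ => trivial

/-- Point masses determine a measure on a finite discrete space. Allowing a second space Ω' lets
variables on unrelated spaces be pullbacks from one model. -/
theorem ProbSpace.measurePreserving_law_of_real_eq {Ω Ω' : ProbSpace.{u}} {A : Type u} [Finite A]
    {f : Ω.carrier → A} {hf : @Measurable _ _ _ ⊤ f} {f' : Ω'.carrier → A}
    (hf' : @Measurable _ _ _ ⊤ f')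
    (h : ∀ a, Ω'.μ.real (f' ⁻¹' {a}) = Ω.μ.real (f ⁻¹' {a})) :
    MeasurePreserving (β := (Ω.law f hf).carrier) f' Ω'.μ (Ω.law f hf).μ := by
  let _ : MeasurableSpace A := ⊤
  refine ⟨hf', Measure.ext_of_singleton (α := A) fun a => ?_⟩
  have h1 : Ω'.μ.map f' {a} = Ω.μ.map f {a} := by
    rw [Measure.map_apply hf' trivial, Measure.map_apply hf trivial]
    exact (measureReal_eq_measureReal_iff).1 (h a)
  exact h1

end FinInfo

namespace FinInfo

/-! ### Deterministic factorizations -/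

section Deterministic

variable {Ω : ProbSpace.{u}} {X Y Z : FRV Ω}

theorem joint_of_comp [DecidableEq Y.alphabet] {f : X.alphabet → Y.alphabet}
    (hf : ∀ ω, Y.toFun ω = f (X.toFun ω)) (x : X.alphabet) (y : Y.alphabet) :
    joint X Y x y = if f x = y then X.pmf x else 0 := by
  split_ifs with h
  · have : X.toFun ⁻¹' {x} ∩ Y.toFun ⁻¹' {y} = X.toFun ⁻¹' {x} := by
      ext ω
      simp only [Set.mem_inter_iff, Set.mem_preimage, Set.mem_singleton_iff, hf, and_iff_left_iff_imp]
      rintro rfl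
      exact h
    rw [joint, this, FRV.pmf]
  · have : X.toFun ⁻¹' {x} ∩ Y.toFun ⁻¹' {y} = ∅ := by
      ext ω
      simp only [Set.mem_inter_iff, Set.mem_preimage, Set.mem_singleton_iff, hf,
        Set.mem_empty_iff_false, iff_false, not_and]
      rintro rfl
      exact h
    rw [joint, this, measureReal_empty]

theorem condDist_of_comp [DecidableEq Y.alphabet] {f : X.alphabet → Y.alphabet}
    (hf : ∀ ω, Y.toFun ω = f (X.toFun ω)) {x : X.alphabet} (hx : X.pmf x ≠ 0) (y : Y.alphabet) :
    condDist X Y x y = if f x = y then 1 else 0 := by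
  rw [condDist, if_pos hx, joint_of_comp hf]
  split_ifs
  · exact div_self hx
  · exact zero_div _

theorem isMarkovTriangle_of_comp {f : X.alphabet → Y.alphabet} {g : Y.alphabet → Z.alphabet}
    (hf : ∀ ω, Y.toFun ω = f (X.toFun ω)) (hg : ∀ ω, Z.toFun ω = g (Y.toFun ω)) :
    IsMarkovTriangle X Y Z := by
  classical
  refine ⟨fun a => f a.2, fun z x => ?_⟩
  by_cases hx : X.pmf x = 0
  · simp [condDist, hx]
  have hxy : condDist X Y x (f x) = 1 := by rw [condDist_of_comp hf hx, if_pos rfl]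
  have hy : Y.pmf (f x) ≠ 0 := pmf_ne_zero_of_condDist X Y (by rw [hxy]; exact one_ne_zero)
  rw [hxy, mul_one, condDist_of_comp hg hy,
    condDist_of_comp (f := g ∘ f) (fun ω => by rw [hg, hf]; rfl) hx]
  rfl

/-- The constant random variable. -/
def FRV.const (Ω : ProbSpace.{u}) : FRV Ω where
  alphabet := PUnit
  toFun := fun _ => PUnit.unit
  surj := fun _ => by
    have := nonempty_of_isProbabilityMeasure Ω.μ
    exact ⟨Classical.arbitrary _, rfl⟩
  measurableSet_fiber := fun x => by simp

theorem FRV.isConstant_const (Ω : ProbSpace.{u}) : (FRV.const Ω).IsConstant := fun _ _ => rfl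

end Deterministic

/-! ### Reduction to the diagonal -/

section Characterization

variable {F : PairMap.{u}}

/-- A map satisfying the axioms sends a pair in which the second variable is a function of the
first one to its value on the diagonal of the second. -/
theorem SatisfiesAxioms.apply_of_comp (hF : SatisfiesAxioms F) {Ω : ProbSpace.{u}} {X Y : FRV Ω}
    (f : X.alphabet → Y.alphabet) (hf : ∀ ω, Y.toFun ω = f (X.toFun ω)) : F Ω X Y = F Ω Y Y := by
  have hC := hF.vanishesOnConstants Ω
  -- Vacuity kills both terms involving the constant, leaving 0 = F(X,Y) - F(Y,Y).
  have h := hF.weaklyFunctorial Ω X Y (FRV.const Ω)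
    (isMarkovTriangle_of_comp hf (g := fun _ => PUnit.unit) fun _ => rfl)
  rw [hC X _ (FRV.isConstant_const Ω), hC Y _ (FRV.isConstant_const Ω)] at h
  linarith

/-- On the law of X, the variables I = id and J = e pull back to X and X'. Each is a function of the
other, so F(I,J) = F(J,J) and F(J,I) = F(I,I); symmetry equates the two. -/
theorem SatisfiesAxioms.apply_of_pmf_eq (hF : SatisfiesAxioms F) {Ω Ω' : ProbSpace.{u}} {X : FRV Ω}
    {X' : FRV Ω'} (e : X.alphabet ≃ X'.alphabet) (he : ∀ x, X'.pmf (e x) = X.pmf x) :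
    F Ω X X = F Ω' X' X' := by
  have hm := measurable_top_of_finite X.measurableSet_fiber
  let I := Ω.lawFRV X.toFun hm id Function.surjective_id
  let J := Ω.lawFRV X.toFun hm e e.surjective
  have hI : F _ I I = F Ω X X :=
    hF.invariantUnderPullbacks (Ω.law X.toFun hm) Ω X.toFun
      (ProbSpace.measurePreserving_law_of_real_eq (hf := hm) hm fun _ => rfl) I I
      (by exact X.surj) (by exact X.surj)
  have hpre : ∀ x, (fun ω => e.symm (X'.toFun ω)) ⁻¹' {x} = X'.toFun ⁻¹' {e x} := by
    intro x
    ext ω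
    simp [Equiv.symm_apply_eq]
  have hm' : @Measurable _ _ _ ⊤ fun ω => e.symm (X'.toFun ω) :=
    measurable_top_of_finite fun x => by
      rw [hpre]
      exact X'.measurableSet_fiber _
  have hπ := ProbSpace.measurePreserving_law_of_real_eq (hf := hm) hm' fun x => by
    rw [hpre]
    exact he x
  have hcomp : J.toFun ∘ (fun ω => e.symm (X'.toFun ω)) = X'.toFun := by
    funext ω
    exact e.apply_symm_apply _
  have hJ : F _ J J = F Ω' X' X' := by
    have hs : Function.Surjective (J.toFun ∘ fun ω => e.symm (X'.toFun ω)) := by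
      rw [hcomp]
      exact X'.surj
    have hX' : J.pullback _ hπ hs = X' := by
      obtain ⟨A, f, _, _⟩ := X'
      simp only [FRV.pullback]
      congr 1
    rw [hF.invariantUnderPullbacks _ Ω' _ hπ J J hs hs, hX']
  have hIJ : F _ I J = F _ J J := hF.apply_of_comp e fun _ => rfl
  have hJI : F _ J I = F _ I I := hF.apply_of_comp e.symm fun _ => (e.symm_apply_apply _).symm
  rw [← hI, ← hJ, ← hIJ, ← hJI, hF.symmetric]

/-! ### The pair variable as mediator -/

section Pairing

variable {Ω : ProbSpace.{u}} {U V W : FRV Ω} (e : W.alphabet ≃ U.alphabet × V.alphabet)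

theorem pmf_eq_joint_of_equiv (he : ∀ ω, e (W.toFun ω) = (U.toFun ω, V.toFun ω)) (x : U.alphabet)
    (y : V.alphabet) : W.pmf (e.symm (x, y)) = joint U V x y := by
  rw [FRV.pmf, joint]
  congr 1
  ext ω
  simp [Equiv.eq_symm_apply, he]

theorem entropy_eq_jointEntropy_of_equiv (he : ∀ ω, e (W.toFun ω) = (U.toFun ω, V.toFun ω)) :
    entropy W = jointEntropy U V := by
  rw [entropy_eq, jointEntropy_eq, ← e.symm.sum_comp, Fintype.sum_prod_type]
  simp_rw [pmf_eq_joint_of_equiv e he]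

theorem isMarkovTriangle_of_equiv (he : ∀ ω, e (W.toFun ω) = (U.toFun ω, V.toFun ω)) :
    IsMarkovTriangle U W V := by
  classical
  -- The mediator is the pair (x,y) itself, which determines y. If it has mass zero, the factor
  -- q(y|(x,y)) is 0 by convention, but q((x,y)|x) is then 0 as well.
  refine ⟨fun a => e.symm (a.2, a.1), fun y x => ?_⟩
  have h1 : joint U W x (e.symm (x, y)) = W.pmf (e.symm (x, y)) := by
    rw [joint_comm, joint_of_comp (f := fun w => (e w).1) fun ω => by rw [he], if_pos (by simp)]
  by_cases hx : U.pmf x = 0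
  · simp [condDist, hx]
  have h3 : condDist U V x y = condDist U W x (e.symm (x, y)) := by
    rw [condDist, condDist, if_pos hx, if_pos hx, h1, pmf_eq_joint_of_equiv e he]
  by_cases hw : W.pmf (e.symm (x, y)) = 0
  · have h4 : condDist U W x (e.symm (x, y)) = 0 := by
      rw [condDist, if_pos hx, h1, hw, zero_div]
    rw [h3, h4, mul_zero]
  · rw [condDist_of_comp (f := fun w => (e w).2) (fun ω => by rw [he]) hw, if_pos (by simp), one_mul,
      h3]

theorem SatisfiesAxioms.eq_of_diagonal_of_equiv (hF : SatisfiesAxioms F) {c : ℝ}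
    (hc : ∀ (Ω : ProbSpace.{u}) (X : FRV Ω), F Ω X X = c * entropy X)
    (he : ∀ ω, e (W.toFun ω) = (U.toFun ω, V.toFun ω)) : F Ω U V = c * mutualInfo Ω U V := by
  have h := hF.weaklyFunctorial Ω U W V (isMarkovTriangle_of_equiv e he)
  rw [hF.symmetric Ω U W, hF.apply_of_comp (X := W) (Y := U) (fun w => (e w).1) fun ω => by rw [he],
    hF.apply_of_comp (X := W) (Y := V) (fun w => (e w).2) fun ω => by rw [he], hc, hc, hc,
    entropy_eq_jointEntropy_of_equiv e he] at h
  rw [h, mutualInfo]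
  ring

end Pairing

/-- A map satisfying the axioms that is a multiple of the entropy on the diagonal is the same
multiple of the mutual information. -/
theorem SatisfiesAxioms.eq_of_diagonal (hF : SatisfiesAxioms F) {c : ℝ}
    (hc : ∀ (Ω : ProbSpace.{u}) (X : FRV Ω), F Ω X X = c * entropy X) (Ω : ProbSpace.{u})
    (X Y : FRV Ω) : F Ω X Y = c * mutualInfo Ω X Y := by
  -- This map may miss pairs, so it need not be a random variable onto the product. On its law the
  -- carrier is the whole product, where the identity and both projections are surjective.
  let f : Ω.carrier → X.alphabet × Y.alphabet := fun ω => (X.toFun ω, Y.toFun ω)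
  have hpre : ∀ a, f ⁻¹' {a} = X.toFun ⁻¹' {a.1} ∩ Y.toFun ⁻¹' {a.2} := by
    intro a
    ext ω
    simp [f, Prod.ext_iff]
  have hm : @Measurable _ _ _ ⊤ f := measurable_top_of_finite fun a => by
    rw [hpre]
    exact (X.measurableSet_fiber _).inter (Y.measurableSet_fiber _)
  have hne : Nonempty Ω.carrier := nonempty_of_isProbabilityMeasure Ω.μ
  have : Nonempty X.alphabet := hne.map X.toFun
  have : Nonempty Y.alphabet := hne.map Y.toFun
  have hπ := ProbSpace.measurePreserving_law_of_real_eq (hf := hm) hm fun _ => rfl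
  let W := Ω.lawFRV f hm id Function.surjective_id
  let U := Ω.lawFRV f hm Prod.fst Prod.fst_surjective
  let V := Ω.lawFRV f hm Prod.snd Prod.snd_surjective
  have hUV : F (Ω.law f hm) U V = F Ω X Y :=
    hF.invariantUnderPullbacks (Ω.law f hm) Ω f hπ U V (by exact X.surj) (by exact Y.surj)
  have hI : mutualInfo (Ω.law f hm) U V = mutualInfo Ω X Y :=
    mutualInfo_invariant (Ω.law f hm) Ω f hπ U V (by exact X.surj) (by exact Y.surj)
  rw [← hUV, ← hI]
  exact hF.eq_of_diagonal_of_equiv (U := U) (V := V) (W := W)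
    (Equiv.refl (X.alphabet × Y.alphabet)) hc fun _ => rfl

end Characterization

end FinInfo

namespace FinInfo

/-! ### Completely additive functions -/

/-- Integer combinations of two positive numbers with natural coefficients get arbitrarily close
to zero from above. -/
theorem exists_nat_mul_sub_mem_Icc {a b ε : ℝ} (ha : 0 < a) (hb : 0 < b) (hε : 0 < ε) :
    ∃ k l : ℕ, 0 < l ∧ 0 ≤ l * a - k * b ∧ l * a - k * b ≤ ε := by
  -- Dirichlet approximation of a/b gives |l a - k b| ≤ b/(n+1), which is below ε since n > b/ε.
  obtain ⟨n, hn⟩ := exists_nat_gt (max (b / ε) (b / a))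
  have hnε : b / ε < n := (le_max_left _ _).trans_lt hn
  have hna : b / a < n := (le_max_right _ _).trans_lt hn
  have hn0 : 0 < n := by exact_mod_cast (div_pos hb hε).trans hnε
  obtain ⟨l, hl, -, h⟩ := Real.exists_nat_abs_mul_sub_round_le (a / b) hn0
  have hround : (0 : ℤ) ≤ round (l * (a / b)) := by
    rw [round_eq]
    exact Int.floor_nonneg.2 (by positivity)
  obtain ⟨k, hk⟩ := Int.eq_ofNat_of_zero_le hround
  rw [hk] at h
  set δ := l * a - k * b with hδ
  have hδ' : |δ| ≤ b / (n + 1) := by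
    have : δ = b * (l * (a / b) - ((k : ℤ) : ℝ)) := by
      rw [hδ]
      push_cast
      field_simp
    rw [this, abs_mul, abs_of_pos hb, div_eq_mul_one_div b]
    exact mul_le_mul_of_nonneg_left h hb.le
  have hn0' : (0 : ℝ) < n := by exact_mod_cast hn0
  have hδn : |δ| < b / n := hδ'.trans_lt (by gcongr; linarith)
  have hδε : |δ| ≤ ε := hδn.le.trans (by
    rw [div_lt_iff₀ hε] at hnε
    rw [div_le_iff₀ hn0']
    linarith)
  rcases le_or_gt 0 δ with h0 | h0
  · exact ⟨k, l, hl, h0, (le_abs_self δ).trans hδε⟩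
  · have hpos : 0 < -δ := by linarith
    -- For δ < 0, adding q copies of δ to a leaves a remainder in [0, -δ); the new coefficients are
    -- 1 + q l and q k.
    set q := ⌊a / -δ⌋₊
    have hq1 : (q : ℝ) * -δ ≤ a := by
      rw [← le_div_iff₀ hpos]
      exact Nat.floor_le (by positivity)
    have hq2 : a < (q + 1) * -δ := by
      rw [← div_lt_iff₀ hpos]
      exact Nat.lt_floor_add_one _
    refine ⟨q * k, 1 + q * l, by omega, ?_, ?_⟩
    · push_cast
      nlinarith
    · rw [abs_of_neg h0] at hδε
      push_cast
      nlinarith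

/-- Choose powers with n^k ≤ m^l ≤ e^ε n^k. Monotonicity of j φ(j) and additivity give k φ(n) ≤ e^ε
l φ(m); as k log n is within ε of l log m, dividing by l and letting ε → 0 yields the bound.
Exchanging m and n gives equality. -/
theorem log_le_of_completelyAdditive {φ : ℕ → ℝ} (h0 : ∀ n, 0 ≤ φ n)
    (hmul : ∀ m n, 0 < m → 0 < n → φ (m * n) = φ m + φ n)
    (hmono : ∀ m n, 0 < m → m ≤ n → m * φ m ≤ n * φ n) {m n : ℕ} (hm : 2 ≤ m) (hn : 2 ≤ n) :
    φ n * Real.log m ≤ φ m * Real.log n := by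
  have h1 : φ 1 = 0 := by simpa using hmul 1 1 one_pos one_pos
  have hpow : ∀ m k : ℕ, 0 < m → φ (m ^ k) = k * φ m := by
    intro m k hm
    induction k with
    | zero => simp [h1]
    | succ k ih =>
      rw [pow_succ, hmul _ _ (by positivity) hm, ih]
      push_cast
      ring
  have hlm : 0 < Real.log m := Real.log_pos (by exact_mod_cast hm)
  have hln : 0 < Real.log n := Real.log_pos (by exact_mod_cast hn)
  have hε : ∀ ε : ℝ, 0 < ε →
      φ n * Real.log m ≤ Real.exp ε * (φ m * Real.log n) + φ n * ε := by
    intro ε hε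
    obtain ⟨k, l, hl, hkl, hkl'⟩ := exists_nat_mul_sub_mem_Icc hlm hln hε
    have hnk : (0 : ℝ) < (n : ℝ) ^ k := by positivity
    have hml : (0 : ℝ) < (m : ℝ) ^ l := by positivity
    have hle : n ^ k ≤ m ^ l := by
      have : (n : ℝ) ^ k ≤ (m : ℝ) ^ l := by
        rw [← Real.log_le_log_iff hnk hml, Real.log_pow, Real.log_pow]
        linarith
      exact_mod_cast this
    have hle' : (m : ℝ) ^ l ≤ Real.exp ε * (n : ℝ) ^ k := by
      rw [← Real.log_le_log_iff hml (by positivity), Real.log_mul (Real.exp_ne_zero _) hnk.ne',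
        Real.log_exp, Real.log_pow, Real.log_pow]
      linarith
    have h := hmono _ _ (by positivity) hle
    rw [hpow n k (by omega), hpow m l (by omega)] at h
    push_cast at h
    have hlφ : 0 ≤ l * φ m := mul_nonneg l.cast_nonneg (h0 m)
    have h2 : (n : ℝ) ^ k * (k * φ n) ≤ (n : ℝ) ^ k * (Real.exp ε * (l * φ m)) := by
      refine h.trans ((mul_le_mul_of_nonneg_right hle' hlφ).trans_eq ?_)
      ring
    have h3 : k * φ n ≤ Real.exp ε * (l * φ m) := le_of_mul_le_mul_left h2 hnk
    have hl' : (1 : ℝ) ≤ l := by exact_mod_cast hl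
    have h4 : (l : ℝ) * (φ n * Real.log m) ≤
        l * (Real.exp ε * (φ m * Real.log n) + φ n * ε) := by
      have h5 := mul_le_mul_of_nonneg_right h3 hln.le
      have h6 := mul_le_mul_of_nonneg_left hkl' (h0 n)
      have h7 : φ n * ε ≤ l * (φ n * ε) :=
        le_mul_of_one_le_left (mul_nonneg (h0 n) hε.le) hl'
      linarith
    exact le_of_mul_le_mul_left h4 (by linarith)
  have hlim : Tendsto (fun ε : ℝ => Real.exp ε * (φ m * Real.log n) + φ n * ε) (𝓝[>] 0)
      (𝓝 (Real.exp 0 * (φ m * Real.log n) + φ n * 0)) := by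
    refine Tendsto.mono_left (Continuous.tendsto ?_ 0) nhdsWithin_le_nhds
    fun_prop
  have := ge_of_tendsto hlim (eventually_mem_nhdsWithin.mono fun ε h => hε ε h)
  simpa using this

/-- A non-negative completely additive function `φ` on the positive integers for which `n * φ n` is
monotone is a multiple of the logarithm. -/
theorem exists_eq_mul_log {φ : ℕ → ℝ} (h0 : ∀ n, 0 ≤ φ n)
    (hmul : ∀ m n, 0 < m → 0 < n → φ (m * n) = φ m + φ n)
    (hmono : ∀ m n, 0 < m → m ≤ n → m * φ m ≤ n * φ n) :
    ∃ c : ℝ, 0 ≤ c ∧ ∀ n, 0 < n → φ n = c * Real.log n := by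
  have h2 : 0 < Real.log (2 : ℕ) := Real.log_pos (by norm_num)
  refine ⟨φ 2 / Real.log (2 : ℕ), div_nonneg (h0 2) h2.le, fun n hn => ?_⟩
  rcases Nat.lt_or_ge n 2 with h | h
  · obtain rfl : n = 1 := by omega
    simpa using hmul 1 1 one_pos one_pos
  · have := le_antisymm (log_le_of_completelyAdditive h0 hmul hmono h le_rfl)
      (log_le_of_completelyAdditive h0 hmul hmono le_rfl h)
    field_simp
    linarith

end FinInfo

namespace FinInfo

/-! ### The diagonal is a multiple of entropy -/

section Diagonal

variable {F : PairMap.{u}}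

/-- The common value of `F(X, X)` over the variables `X` distributed uniformly on `n` letters. -/
noncomputable def uniformValue (F : PairMap.{u}) (n : ℕ) : ℝ :=
  open Classical in
  if h : ∃ a : Σ Ω : ProbSpace.{u}, FRV Ω,
      Nat.card a.2.alphabet = n ∧ ∀ x, a.2.pmf x = (n : ℝ)⁻¹ then
    F h.choose.1 h.choose.2 h.choose.2
  -- Reached only for n = 0, since a probability space is non-empty and so is every alphabet.
  else 0

theorem uniformValue_nonneg (hF0 : ∀ (Ω : ProbSpace.{u}) (X Y : FRV Ω), 0 ≤ F Ω X Y) (n : ℕ) :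
    0 ≤ uniformValue F n := by
  unfold uniformValue
  split_ifs
  · exact hF0 _ _ _
  · exact le_rfl

theorem SatisfiesAxioms.apply_uniform (hF : SatisfiesAxioms F) {Ω : ProbSpace.{u}} (X : FRV Ω)
    {n : ℕ} (hn : Nat.card X.alphabet = n) (hX : ∀ x, X.pmf x = (n : ℝ)⁻¹) :
    F Ω X X = uniformValue F n := by
  have h : ∃ a : Σ Ω : ProbSpace.{u}, FRV Ω,
      Nat.card a.2.alphabet = n ∧ ∀ x, a.2.pmf x = (n : ℝ)⁻¹ := ⟨⟨Ω, X⟩, hn, hX⟩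
  rw [uniformValue, dif_pos h]
  obtain ⟨h1, h2⟩ := h.choose_spec
  exact hF.apply_of_pmf_eq ((Finite.card_eq.1 (hn.trans h1.symm)).some) fun x => by rw [h2, hX]

/-- The grouping identity for a uniform distribution. -/
theorem SatisfiesAxioms.apply_add_sum (hF : SatisfiesAxioms F) {Ω : ProbSpace.{u}} (X : FRV Ω)
    {k : X.alphabet → ℕ} (hk : ∀ x, 0 < k x) {N : ℕ} (hN : ∑ x, k x = N)
    (hX : ∀ x, X.pmf x = k x / N) :
    F Ω X X + ∑ x, X.pmf x * uniformValue F (k x) = uniformValue F N := by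
  -- Split each letter x into k x equiprobable ones: every new letter has mass (k x / N)(1 / k x) =
  -- 1/N.
  have : ∀ x, Nonempty (ULift.{u} (Fin (k x))) := fun x => ⟨⟨⟨0, hk x⟩⟩⟩
  obtain ⟨Ω', Y, hs, hm, hY⟩ := exists_frv_pmf_eq (fun x => ULift.{u} (Fin (k x)))
    fun x => uniformDist _
  let Y' : X.alphabet → FRV Ω' := fun x => FRV.mk (ULift.{u} (Fin (k x))) (Y x) (hs x) (hm x)
  have hcard : ∀ x, Nat.card (Y' x).alphabet = k x := fun x => by
    simp [Y']
  have hpmf : ∀ x y, (Y' x).pmf y = (k x : ℝ)⁻¹ := fun x y => by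
    rw [hY]
    simp [uniformDist]
  have h := hF.stronglyAdditive Ω X Ω' Y' Y'
  simp_rw [fun x => hF.apply_uniform (Y' x) (hcard x) (hpmf x)] at h
  rw [← h]
  refine hF.apply_uniform _ ?_ ?_
  · have h1 := FRV.sum_convexSum X.dist Y' fun _ => 1
    simp only [Finset.sum_const, Finset.card_univ, ← Nat.card_eq_fintype_card, hcard,
      nsmul_eq_mul, mul_one] at h1
    rw [← hN]
    exact_mod_cast h1
  · rintro ⟨x, y⟩
    refine (FRV.pmf_convexSum X.dist Y' x y).trans ?_
    have hx : (k x : ℝ) ≠ 0 := by exact_mod_cast (hk x).ne'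
    rw [hpmf]
    simp only [FRV.dist]
    rw [hX]
    field_simp

theorem exists_frv {A : Type u} [Fintype A] (p : stdSimplex ℝ A) :
    ∃ (Ω : ProbSpace.{u}) (f : Ω.carrier → A) (hs : Function.Surjective f)
      (hm : ∀ x, MeasurableSet (f ⁻¹' {x})), ∀ x, (FRV.mk A f hs hm).pmf x = p.1 x := by
  obtain ⟨Ω, f, hs, hm, h⟩ := exists_frv_pmf_eq (fun _ : PUnit.{u + 1} => A) fun _ => p
  exact ⟨Ω, f ⟨⟩, hs ⟨⟩, hm ⟨⟩, h ⟨⟩⟩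

/-- The distribution on `A` proportional to the weights `k`. -/
noncomputable def proportionalDist {A : Type u} [Fintype A] [Nonempty A] (k : A → ℕ)
    (hk : ∀ a, 0 < k a) : stdSimplex ℝ A :=
  ⟨fun a => k a / (∑ b, k b : ℕ), fun a => by positivity, by
    have : 0 < ∑ b, k b := Finset.sum_pos (fun b _ => hk b) Finset.univ_nonempty
    rw [← Finset.sum_div, ← Nat.cast_sum]
    exact div_self (by exact_mod_cast this.ne')⟩

theorem SatisfiesAxioms.exists_apply_add_sum (hF : SatisfiesAxioms F) {A : Type u} [Fintype A]
    [Nonempty A] {k : A → ℕ} (hk : ∀ a, 0 < k a) {N : ℕ} (hN : ∑ a, k a = N) :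
    ∃ (Ω : ProbSpace.{u}) (X : FRV Ω),
      F Ω X X + ∑ a, k a / N * uniformValue F (k a) = uniformValue F N := by
  obtain ⟨Ω, f, hs, hm, h⟩ := exists_frv (proportionalDist k hk)
  let X := FRV.mk A f hs hm
  have hsum : ∀ {M : Type} [AddCommMonoid M] (g : A → M),
      (@Finset.univ X.alphabet X.fintype).sum g = ∑ a : A, g a := fun g => Finset.sum_congr (by congr!) fun _ _ => rfl
  have hX : ∀ x : X.alphabet, X.pmf x = k x / N := fun x => by
    rw [h]
    simp only [proportionalDist, hN]
  refine ⟨Ω, X, ?_⟩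
  rw [← hF.apply_add_sum X hk ((hsum k).trans hN) hX]
  simp_rw [hX]
  rw [hsum fun a => k a / N * uniformValue F (k a)]

/-- Grouping m n equiprobable letters into m blocks of size n. -/
theorem SatisfiesAxioms.uniformValue_mul (hF : SatisfiesAxioms F) (m n : ℕ) (hm : 0 < m)
    (hn : 0 < n) : uniformValue F (m * n) = uniformValue F m + uniformValue F n := by
  have : Nonempty (ULift.{u} (Fin m)) := ⟨⟨⟨0, hm⟩⟩⟩
  obtain ⟨Ω, f, hs, hm', h⟩ := exists_frv (uniformDist (ULift.{u} (Fin m)))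
  let X := FRV.mk _ f hs hm'
  have hcard : Nat.card X.alphabet = m := by
    simp [X]
  have hcard' : (@Finset.univ X.alphabet X.fintype).card = m := by
    rw [← hcard]
    exact (@Nat.card_eq_fintype_card _ X.fintype).symm
  have hm0 : (m : ℝ) ≠ 0 := by exact_mod_cast hm.ne'
  have hn0 : (n : ℝ) ≠ 0 := by exact_mod_cast hn.ne'
  have hX : ∀ x, X.pmf x = (m : ℝ)⁻¹ := fun x => by
    rw [h]
    simp [uniformDist]
  rw [← hF.apply_add_sum X (k := fun _ => n) (fun _ => hn) (N := m * n) (by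
    simp only [Finset.sum_const, hcard', smul_eq_mul]) fun x => by
    rw [hX]
    push_cast
    field_simp, hF.apply_uniform X hcard hX]
  simp_rw [← Finset.sum_mul, X.sum_pmf, one_mul]

/-- Group n letters into blocks of sizes m and n - m, then discard the two non-negative terms other
than (m/n) φ(m). -/
theorem SatisfiesAxioms.mul_uniformValue_mono (hF : SatisfiesAxioms F)
    (hF0 : ∀ (Ω : ProbSpace.{u}) (X Y : FRV Ω), 0 ≤ F Ω X Y) (m n : ℕ) (hm : 0 < m)
    (hmn : m ≤ n) : m * uniformValue F m ≤ n * uniformValue F n := by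
  rcases hmn.eq_or_lt with rfl | hlt
  · exact le_rfl
  obtain ⟨Ω, X, h⟩ := hF.exists_apply_add_sum (A := ULift.{u} Bool)
    (k := fun b => if b.down then m else n - m) (N := n)
    (fun b => by split_ifs <;> omega) (by
      rw [← Equiv.ulift.symm.sum_comp]
      simp
      omega)
  rw [← Equiv.ulift.symm.sum_comp] at h
  have hn : (0 : ℝ) < n := by exact_mod_cast hm.trans hlt
  have h1 : 0 ≤ ((n - m : ℕ) : ℝ) / n * uniformValue F (n - m) :=
    mul_nonneg (by positivity) (uniformValue_nonneg hF0 _)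
  have h2 := hF0 Ω X X
  simp only [Fintype.sum_bool, Equiv.ulift_symm_apply, if_true, Bool.false_eq_true, if_false] at h
  have h3 : (m : ℝ) / n * uniformValue F m ≤ uniformValue F n := by linarith
  rw [div_mul_eq_mul_div, div_le_iff₀ hn] at h3
  linarith

/-- The grouping identity solved for F(X,X): c log N - ∑ p(x) c log k(x) = -c ∑ p(x) log(k(x)/N). -/
theorem SatisfiesAxioms.apply_eq_of_proportional (hF : SatisfiesAxioms F) {c : ℝ}
    (hc : ∀ n, 0 < n → uniformValue F n = c * Real.log n) {Ω : ProbSpace.{u}} (X : FRV Ω)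
    {k : X.alphabet → ℕ} (hk : ∀ x, 0 < k x) {N : ℕ} (hN : ∑ x, k x = N)
    (hX : ∀ x, X.pmf x = k x / N) : F Ω X X = c * entropy X := by
  have hne : Nonempty Ω.carrier := nonempty_of_isProbabilityMeasure Ω.μ
  have : Nonempty X.alphabet := hne.map X.toFun
  have hN0 : 0 < N := hN ▸ Finset.sum_pos (fun b _ => hk b) Finset.univ_nonempty
  have hN' : (0 : ℝ) < N := by exact_mod_cast hN0
  have h := hF.apply_add_sum X hk hN hX
  have h1 : c * entropy X =
      c * Real.log N - ∑ x, X.pmf x * uniformValue F (k x) := by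
    have : c * Real.log N = ∑ x, X.pmf x * (c * Real.log N) := by
      rw [← Finset.sum_mul, X.sum_pmf, one_mul]
    rw [this, ← Finset.sum_sub_distrib, entropy_eq, Finset.mul_sum]
    refine Finset.sum_congr rfl fun x _ => ?_
    have hkx : (0 : ℝ) < k x := by exact_mod_cast hk x
    rw [hc _ (hk x), Real.negMulLog, hX, Real.log_div hkx.ne' hN'.ne']
    ring
  rw [h1, ← hc N hN0]
  linarith

/-- Every distribution is a limit of distributions with positive rational weights. -/
theorem exists_tendsto_proportional {A : Type u} [Fintype A] [Nonempty A] (p : stdSimplex ℝ A) :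
    ∃ (k : ℕ → A → ℕ) (hk : ∀ n a, 0 < k n a),
      ∀ a, Tendsto (fun n => (proportionalDist (k n) (hk n)).1 a) atTop (𝓝 (p.1 a)) := by
  -- The added 1 keeps weights positive even where p vanishes, and is negligible after division by
  -- n.
  refine ⟨fun n a => ⌊p.1 a * n⌋₊ + 1, fun n a => Nat.succ_pos _, fun a => ?_⟩
  have h1 : ∀ a, Tendsto (fun n : ℕ => ((⌊p.1 a * n⌋₊ + 1 : ℕ) : ℝ) / n) atTop (𝓝 (p.1 a)) := by
    intro a
    have h := ((tendsto_nat_floor_mul_div_atTop (p.2.1 a)).comp tendsto_natCast_atTop_atTop).add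
      (tendsto_one_div_atTop_nhds_zero_nat (𝕜 := ℝ))
    rw [add_zero] at h
    refine h.congr fun n => ?_
    simp only [Function.comp_apply]
    push_cast
    ring
  have h2 : Tendsto (fun n : ℕ => ((∑ b, (⌊p.1 b * n⌋₊ + 1) : ℕ) : ℝ) / n) atTop (𝓝 1) := by
    have h := tendsto_finsetSum Finset.univ fun b _ => h1 b
    rw [p.2.2] at h
    refine h.congr fun n => ?_
    rw [← Finset.sum_div]
    push_cast
    rfl
  have h3 := (h1 a).div h2 one_ne_zero
  rw [div_one] at h3
  refine h3.congr' ?_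
  filter_upwards [eventually_gt_atTop 0] with n hn
  have hn' : (n : ℝ) ≠ 0 := by exact_mod_cast hn.ne'
  simp only [Pi.div_apply, proportionalDist]
  exact div_div_div_cancel_right₀ hn' _ _

theorem mutualInfo_self {Ω : ProbSpace.{u}} (X : FRV Ω) : mutualInfo Ω X X = entropy X := by
  rw [mutualInfo, jointEntropy_self, add_sub_cancel_right]

theorem SatisfiesAxioms.diagonal_eq (hF : SatisfiesAxioms F) {c : ℝ}
    (hc : ∀ n, 0 < n → uniformValue F n = c * Real.log n) (Ω : ProbSpace.{u}) (X : FRV Ω) :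
    F Ω X X = c * entropy X := by
  classical
  have hne : Nonempty Ω.carrier := nonempty_of_isProbabilityMeasure Ω.μ
  have : Nonempty X.alphabet := hne.map X.toFun
  obtain ⟨k, hk, hlim⟩ := exists_tendsto_proportional X.dist
  -- Continuity concerns a single space, so the approximants (`some`) and a copy of the limit
  -- (`none`) are built together; `apply_of_pmf_eq` then returns from the copy to X.
  obtain ⟨Ω', Y, hs, hm, hY⟩ := exists_frv_pmf_eq (fun _ : Option (ULift.{u} ℕ) => X.alphabet)
    fun i => i.elim X.dist fun n => proportionalDist (k n.down) (hk n.down)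
  let Y' : Option (ULift.{u} ℕ) → FRV Ω' := fun i => FRV.mk X.alphabet (Y i) (hs i) (hm i)
  have hconv : PairConverges (fun n => Y' (some ⟨n⟩)) (fun n => Y' (some ⟨n⟩)) (Y' none)
      (Y' none) := by
    refine ⟨0, fun _ => rfl, fun _ => rfl, fun x y => ?_⟩
    have h1 : ∀ n, joint (Y' (some ⟨n⟩)) (Y' (some ⟨n⟩)) x y =
        if x = y then (proportionalDist (k n) (hk n)).1 x else 0 := fun n =>
      (joint_self (Y' (some ⟨n⟩)) x y).trans (if_congr Iff.rfl (hY (some ⟨n⟩) x) rfl)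
    have h2 : joint (Y' none) (Y' none) x y = if x = y then X.dist.1 x else 0 :=
      (joint_self (Y' none) x y).trans (if_congr Iff.rfl (hY none x) rfl)
    rw [h2]
    refine Tendsto.congr (fun n => (h1 n).symm) ?_
    split_ifs
    · exact hlim x
    · exact tendsto_const_nhds
  have hF1 := hF.continuous Ω' _ _ _ _ hconv
  have hI := (mutualInfo_continuous Ω' _ _ _ _ hconv).const_mul c
  have heq : ∀ n, F Ω' (Y' (some ⟨n⟩)) (Y' (some ⟨n⟩)) =
      c * mutualInfo Ω' (Y' (some ⟨n⟩)) (Y' (some ⟨n⟩)) := by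
    intro n
    rw [mutualInfo_self]
    refine hF.apply_eq_of_proportional hc (Y' (some ⟨n⟩)) (k := k n) (hk n) (N := ∑ b, k n b)
      (Finset.sum_congr (by congr!) fun _ _ => rfl) fun x => hY (some ⟨n⟩) x
  simp_rw [heq] at hF1
  have hlast := tendsto_nhds_unique hF1 hI
  rw [mutualInfo_self] at hlast
  have hpm : ∀ x : X.alphabet, (Y' none).pmf x = X.pmf x := fun x => hY none x
  rw [hF.apply_of_pmf_eq (X := X) (X' := Y' none) (Equiv.refl X.alphabet) hpm, hlast]
  congr 1
  rw [entropy_eq, entropy_eq]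
  exact Finset.sum_congr (by congr!) fun x _ => congrArg _ (hpm x)

end Diagonal

end FinInfo

theorem mainTheorem1 :
    (∀ F : FinInfo.PairMap.{u},
      (∀ (Ω : FinInfo.ProbSpace.{u}) (X Y : FinInfo.FRV Ω), 0 ≤ F Ω X Y) →
      FinInfo.SatisfiesAxioms F →
      ∃ c : ℝ, 0 ≤ c ∧ ∀ (Ω : FinInfo.ProbSpace.{u}) (X Y : FinInfo.FRV Ω),
        F Ω X Y = c * FinInfo.mutualInfo Ω X Y) ∧
    (∀ (Ω : FinInfo.ProbSpace.{u}) (X Y : FinInfo.FRV Ω), 0 ≤ FinInfo.mutualInfo Ω X Y) ∧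
    FinInfo.SatisfiesAxioms FinInfo.mutualInfo.{u} := by
  refine ⟨fun F hF0 hF => ?_, FinInfo.mutualInfo_nonneg, FinInfo.mutualInfo_satisfiesAxioms⟩
  obtain ⟨c, hc0, hc⟩ := FinInfo.exists_eq_mul_log (FinInfo.uniformValue_nonneg hF0)
    hF.uniformValue_mul (hF.mul_uniformValue_mono hF0)
  exact ⟨c, hc0, hF.eq_of_diagonal (hF.diagonal_eq hc)⟩
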